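/- For $0\le k<1$ let $\operatorname{sn}(x,k),\operatorname{cn}(x,k),\operatorname{dn}(x,k)$ be the Jacobi elliptic functions of modulus $k$ and let $\operatorname{Ke}(k)=\int_0^{\pi/2}\frac{dx}{\sqrt{1-k^2\sin^2 x}}$. For $\alpha\in(0,1]$ put $r=\sqrt{1+2\alpha}$, $k=\sqrt{\frac{1-\alpha^2}{1+2\alpha}}$, $$R_1(t)=\sqrt{\tfrac{1+\alpha}{2+\alpha}}\,\operatorname{cn}(rt,k),\quad R_2(t)=\sqrt{\tfrac{1+\alpha}{1+2\alpha}}\,\operatorname{sn}(rt,k),\quad R_3(t)=\sqrt{\tfrac{1}{2+\alpha}}\,\operatorname{dn}(rt,k),$$ and, for a fixed $\theta\in\mathbb R$, define $u_{\alpha,0}:\mathbb R^2\to\mathbb C^3$ by $$u_{\alpha,0}(s,t)=\bigl(e^{is}e^{-i(\theta+\pi/2)}R_1(t),\;e^{i\alpha s}R_2(t),\;e^{-i(1+\alpha)s}R_3(t)\bigr).$$ **Proposition.** Let $\alpha\in\mathbb Q\cap(0,1]$, written as $\alpha=m/n$ with positive integers $m\le n$, $\gcd(m,n)=1$. Then $u_{\alpha,0}$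 is a smooth minimal Legendrian immersion of $\mathbb R^2$ into the unit sphere $S^5\subset\mathbb C^3$, and it is doubly periodic (it has two linearly independent periods); its group of periods $\Lambda=\{\omega\in\mathbb R^2: u_{\alpha,0}(p+\omega)=u_{\alpha,0}(p)\ \forall p\}$ is the following lattice. 1. If $mn$ is even, then $\Lambda$ is rectangular (it has an orthogonal $\mathbb Z$-basis), with $\mathbb Z$-basis $\omega_1=(2n\pi,0)$, $\omega_2=(0,4\operatorname{Ke}(k)/r)$. 2. If $mn$ is odd, then $\Lambda$ is not rectangular (it has no orthogonal $\mathbb Z$-basis), and it has the $\mathbb Z$-basis $\omega_1=(2n\pi,0)$, $\omega_3=(n\pi,2\operatorname{Ke}(k)/r)$. In either case the minimal Legendrian torus $T_{m,n}=\mathbb R^2/\Lambda\to S^5$ induced by $u_{\alpha,0}$ is embedded, and the minimum and the maximum of its Gauss curvature $K$ (that of the induced metric) are attained and equal $$K_{\min}=1-\frac{2}{\alpha(1+\alpha)},\qquad K_{\max}=1-\frac{2\alpha^2}{1+\alpha}.$$ -/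

import Mathlib

noncomputable section

namespace LegendrianTori

/-! ### Elliptic integrals and Jacobi elliptic functions of modulus `k` -/

/-- The incomplete elliptic integral of the first kind `F(φ, k)`. -/
def ellipticF (k φ : ℝ) : ℝ :=
  ∫ x in (0 : ℝ)..φ, 1 / Real.sqrt (1 - k ^ 2 * Real.sin x ^ 2)

/-- The complete elliptic integral of the first kind with modulus `k`. -/
def Ke (k : ℝ) : ℝ :=
  ∫ x in (0 : ℝ)..(Real.pi / 2), 1 / Real.sqrt (1 - k ^ 2 * Real.sin x ^ 2)

/-- The Jacobi amplitude, the inverse of `F(·, k)`, which is an increasing bijection of `ℝ`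
for `0 ≤ k < 1`. -/
def am (k : ℝ) : ℝ → ℝ := Function.invFun (ellipticF k)

/-- The Jacobi function `sn (x, k)`. -/
def sn (x k : ℝ) : ℝ := Real.sin (am k x)

/-- The Jacobi function `cn (x, k)`. -/
def cn (x k : ℝ) : ℝ := Real.cos (am k x)

/-- The Jacobi function `dn (x, k)`. -/
def dn (x k : ℝ) : ℝ := Real.sqrt (1 - k ^ 2 * sn x k ^ 2)

/-! ### Geometry of maps from the plane to `ℂ³` -/

/-- The space `ℂ³` with its Hermitian norm. -/
abbrev C3 : Type := EuclideanSpace ℂ (Fin 3)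

/-- The Euclidean inner product of `ℂ³ = ℝ⁶`. -/
def dot3 (v w : C3) : ℝ := (inner ℂ v w).re

/-- The standard symplectic form `∑ dxʲ ∧ dyʲ` of `ℂ³`. -/
def omega3 (v w : C3) : ℝ := (inner ℂ v w).im

/-- The partial derivative in the first variable `s`. -/
def pderivS {F : Type*} [NormedAddCommGroup F] [NormedSpace ℝ F] (f : ℝ × ℝ → F) :
    ℝ × ℝ → F := fun p => fderiv ℝ f p (1, 0)

/-- The partial derivative in the second variable `t`. -/
def pderivT {F : Type*} [NormedAddCommGroup F] [NormedSpace ℝ F] (f : ℝ × ℝ → F) :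
    ℝ × ℝ → F := fun p => fderiv ℝ f p (0, 1)

/-- First fundamental form `E ds² + 2 F ds dt + G dt²` of `u`: the coefficient `E`. -/
def metE (u : ℝ × ℝ → C3) (p : ℝ × ℝ) : ℝ := dot3 (pderivS u p) (pderivS u p)

/-- First fundamental form: the coefficient `F`. -/
def metF (u : ℝ × ℝ → C3) (p : ℝ × ℝ) : ℝ := dot3 (pderivS u p) (pderivT u p)

/-- First fundamental form: the coefficient `G`. -/
def metG (u : ℝ × ℝ → C3) (p : ℝ × ℝ) : ℝ := dot3 (pderivT u p) (pderivT u p)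

/-- The Gauss curvature of the metric `E ds² + 2 F ds dt + G dt²` (Brioschi's formula). -/
def metricGauss (E F G : ℝ × ℝ → ℝ) (p : ℝ × ℝ) : ℝ :=
  (Matrix.det
      !![-(pderivT (pderivT E) p) / 2 + pderivS (pderivT F) p - pderivS (pderivS G) p / 2,
           pderivS E p / 2, pderivS F p - pderivT E p / 2;
         pderivT F p - pderivS G p / 2, E p, F p;
         pderivT G p / 2, F p, G p]
    - Matrix.det
      !![0, pderivT E p / 2, pderivS G p / 2;
         pderivT E p / 2, E p, F p;
         pderivS G p / 2, F p, G p])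
    / (E p * G p - F p ^ 2) ^ 2

/-- The Gauss curvature of the metric induced by an immersion `u`. -/
def gaussCurvature (u : ℝ × ℝ → C3) : ℝ × ℝ → ℝ :=
  metricGauss (metE u) (metF u) (metG u)

/-- `u` is a smooth minimal Legendrian immersion of the plane into the unit sphere `S⁵ ⊂ ℂ³`. -/
structure IsMinimalLegendrianImmersion (u : ℝ × ℝ → C3) : Prop where
  smooth : ContDiff ℝ (⊤ : ℕ∞) u
  mem_sphere : ∀ p, u p ∈ Metric.sphere (0 : C3) 1
  immersion : ∀ p, Function.Injective (fderiv ℝ u p)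
  /-- The contact form `ι_X ω` of the sphere (`X` the Euler field) pulls back to zero. -/
  legendrian : ∀ p v, omega3 (u p) (fderiv ℝ u p v) = 0
  /-- The mean curvature vector in the sphere vanishes: up to the factor `1 / (E G - F²)`, the
  trace of the Hessian of `u` with respect to the induced metric has no component normal to both
  the surface and the position vector. -/
  minimal : ∀ p,
    metG u p • pderivS (pderivS u) p - (2 * metF u p) • pderivS (pderivT u) p
        + metE u p • pderivT (pderivT u) p
      ∈ Submodule.span ℝ ({u p, pderivS u p, pderivT u p} : Set C3)

/-! ### Periods -/

/-- The group of periods of `u`. -/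
def periodGroup (u : ℝ × ℝ → C3) : AddSubgroup (ℝ × ℝ) where
  carrier := {ω | ∀ p, u (p + ω) = u p}
  zero_mem' := fun p => by rw [add_zero]
  add_mem' := fun {a b} ha hb p => by rw [← add_assoc, hb, ha]
  neg_mem' := fun {a} ha p => by rw [← ha (p + -a), neg_add_cancel_right]

/-- `u` is doubly periodic: it has two linearly independent periods. -/
def DoublyPeriodic (u : ℝ × ℝ → C3) : Prop :=
  ∃ v ∈ periodGroup u, ∃ w ∈ periodGroup u, LinearIndependent ℝ ![v, w]

/-- `v, w` is a `ℤ`-basis of `L`, and `L` is a lattice in the plane. -/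
def IsLatticeBasis (L : AddSubgroup (ℝ × ℝ)) (v w : ℝ × ℝ) : Prop :=
  LinearIndependent ℝ ![v, w] ∧ AddSubgroup.closure {v, w} = L

/-- `L` is a rectangular lattice: it has a `ℤ`-basis that is orthogonal for the standard
Euclidean inner product of the plane. -/
def IsRectangular (L : AddSubgroup (ℝ × ℝ)) : Prop :=
  ∃ v w, IsLatticeBasis L v w ∧ v.1 * w.1 + v.2 * w.2 = 0

/-- The quotient of the plane by the periods of `u` (a torus when these form a lattice). -/
abbrev PeriodQuotient (u : ℝ × ℝ → C3) : Type := (ℝ × ℝ) ⧸ periodGroup u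

/-- The map induced by `u` on the quotient by its periods. -/
def quotientMap (u : ℝ × ℝ → C3) : PeriodQuotient u → C3 :=
  Quotient.lift u (fun a b h => by
    have h' : -a + b ∈ periodGroup u := QuotientAddGroup.leftRel_apply.mp h
    have h2 := h' a
    rw [add_neg_cancel_left] at h2
    exact h2.symm)

/-! ### The immersions `u_{α,0}` -/

/-- `r = √(1 + 2α)`. -/
def rOf (α : ℝ) : ℝ := Real.sqrt (1 + 2 * α)

/-- `k = √((1 - α²) / (1 + 2α))`. -/
def kOf (α : ℝ) : ℝ := Real.sqrt ((1 - α ^ 2) / (1 + 2 * α))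

/-- `R₁(t)`. -/
def R1 (α t : ℝ) : ℝ := Real.sqrt ((1 + α) / (2 + α)) * cn (rOf α * t) (kOf α)

/-- `R₂(t)`. -/
def R2 (α t : ℝ) : ℝ := Real.sqrt ((1 + α) / (1 + 2 * α)) * sn (rOf α * t) (kOf α)

/-- `R₃(t)`. -/
def R3 (α t : ℝ) : ℝ := Real.sqrt (1 / (2 + α)) * dn (rOf α * t) (kOf α)

/-- The immersion `u_{α,0}(s,t) = e^{As} (e^{-i(θ+π/2)} R₁(t), R₂(t), R₃(t))` with
`A = i diag(1, α, -1-α)`, in its `θ`-special Legendrian version. -/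
def uZero (α θ : ℝ) (p : ℝ × ℝ) : C3 :=
  !₂[Complex.exp (Complex.I * (p.1 : ℂ)) *
        (Complex.exp (-Complex.I * ((θ : ℂ) + (Real.pi : ℂ) / 2)) * (R1 α p.2 : ℂ)),
     Complex.exp (Complex.I * (α : ℂ) * (p.1 : ℂ)) * (R2 α p.2 : ℂ),
     Complex.exp (Complex.I * (-1 - (α : ℂ)) * (p.1 : ℂ)) * (R3 α p.2 : ℂ)]

end LegendrianTori

end

noncomputable section

namespace LegendrianTori

/-! ### The Jacobi amplitude -/

section Amplitude

variable {k : ℝ}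

/-! Geometry. The three components are waves `e^{i λⱼ s} cⱼ Rⱼ(t)` with `|cⱼ| = 1`, so inner
products of derivatives depend on `t` alone and reduce to quadratic identities for the profile.
These give `E = G = e` and `F = 0` with `e = 1 + α - (1 - α²) sn²`. The profile satisfies `Rⱼ'' =
(λⱼ² - 2e) Rⱼ`, hence `u_ss + u_tt = -2e u` (`pderiv_sum_uZero`), which is minimality. The curvature
is `1 - 2 (α(1 + α))² / e³` (`gaussCurvature_uZero`), increasing in `e`, and `e` ranges between `α(1
+ α)` and `1 + α`.

Periods. In `u p = u q` the positive third component forces its phase factor to be `1`. As the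
frequencies sum to zero, the other two phase factors are inverse to each other; they also relate
real vectors, so they are a common sign. This sign fixes the parities of the multiples of `π` by
which `s`, `αs` and the amplitude change (`uZero_eq_iff_exists_int`). The condition involves only `q
- p`, so level sets are cosets of the period group, and the map induced on the compact quotient is
an injection, hence an embedding. For `mn` odd the lattice is rhombic, and it could be rectangular
only if it were square, which `two_mul_Ke_div_rOf_lt` rules out. -/

lemma one_sub_sq_mul_sin_sq_pos (hk : k ^ 2 < 1) (x : ℝ) : 0 < 1 - k ^ 2 * Real.sin x ^ 2 := by
  nlinarith [Real.sin_sq_le_one x, sq_nonneg k, sq_nonneg (Real.sin x)]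

lemma continuous_ellipticIntegrand (hk : k ^ 2 < 1) :
    Continuous fun x : ℝ => 1 / Real.sqrt (1 - k ^ 2 * Real.sin x ^ 2) := by
  refine continuous_const.div (by fun_prop) fun x => ?_
  exact (Real.sqrt_pos.2 (one_sub_sq_mul_sin_sq_pos hk x)).ne'

lemma one_le_ellipticIntegrand (hk : k ^ 2 < 1) (x : ℝ) :
    1 ≤ 1 / Real.sqrt (1 - k ^ 2 * Real.sin x ^ 2) := by
  rw [le_div_iff₀ (Real.sqrt_pos.2 (one_sub_sq_mul_sin_sq_pos hk x)), one_mul,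
    Real.sqrt_le_one]
  nlinarith [mul_nonneg (sq_nonneg k) (sq_nonneg (Real.sin x))]

lemma hasDerivAt_ellipticF (hk : k ^ 2 < 1) (φ : ℝ) :
    HasDerivAt (ellipticF k) (1 / Real.sqrt (1 - k ^ 2 * Real.sin φ ^ 2)) φ :=
  (continuous_ellipticIntegrand hk).integral_hasStrictDerivAt 0 φ |>.hasDerivAt

lemma strictMono_ellipticF (hk : k ^ 2 < 1) : StrictMono (ellipticF k) :=
  strictMono_of_deriv_pos fun x => by
    rw [(hasDerivAt_ellipticF hk x).deriv]
    exact lt_of_lt_of_le one_pos (one_le_ellipticIntegrand hk x)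

lemma continuous_ellipticF (hk : k ^ 2 < 1) : Continuous (ellipticF k) :=
  continuous_iff_continuousAt.2 fun x => (hasDerivAt_ellipticF hk x).continuousAt

/-- The integrand is at least `1`; comparison with the identity makes `ellipticF k` unbounded in
both directions, hence surjective. -/
lemma monotone_ellipticF_sub_id (hk : k ^ 2 < 1) : Monotone fun x => ellipticF k x - x := by
  refine monotone_of_deriv_nonneg
    (fun x => ((hasDerivAt_ellipticF hk x).sub (hasDerivAt_id x)).differentiableAt) fun x => ?_
  have h : HasDerivAt (fun x => ellipticF k x - x) _ x :=
    (hasDerivAt_ellipticF hk x).sub (hasDerivAt_id x)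
  rw [h.deriv]
  exact sub_nonneg.2 (one_le_ellipticIntegrand hk x)

@[simp] lemma ellipticF_zero : ellipticF k 0 = 0 := by simp [ellipticF]

lemma surjective_ellipticF (hk : k ^ 2 < 1) : Function.Surjective (ellipticF k) := by
  refine (continuous_ellipticF hk).surjective ?_ ?_
  · refine Filter.tendsto_atTop_mono' _ ?_ Filter.tendsto_id
    filter_upwards [Filter.eventually_ge_atTop 0] with x hx
    have := monotone_ellipticF_sub_id hk hx
    simp only [ellipticF_zero] at this
    simp only [id]; linarith
  · refine Filter.tendsto_atBot_mono' _ ?_ Filter.tendsto_id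
    filter_upwards [Filter.eventually_le_atBot 0] with x hx
    have := monotone_ellipticF_sub_id hk hx
    simp only [ellipticF_zero] at this
    simp only [id]; linarith

lemma ellipticF_am (hk : k ^ 2 < 1) (x : ℝ) : ellipticF k (am k x) = x :=
  Function.rightInverse_invFun (surjective_ellipticF hk) x

lemma am_ellipticF (hk : k ^ 2 < 1) (φ : ℝ) : am k (ellipticF k φ) = φ :=
  Function.leftInverse_invFun (strictMono_ellipticF hk).injective φ

lemma continuous_am (hk : k ^ 2 < 1) : Continuous (am k) := by
  refine Monotone.continuous_of_surjective (fun x y hxy => ?_) fun φ => ⟨_, am_ellipticF hk φ⟩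
  rwa [← (strictMono_ellipticF hk).le_iff_le, ellipticF_am hk, ellipticF_am hk]

lemma hasDerivAt_am (hk : k ^ 2 < 1) (x : ℝ) : HasDerivAt (am k) (dn x k) x := by
  have hpos := Real.sqrt_pos.2 (one_sub_sq_mul_sin_sq_pos hk (am k x))
  have h := (hasDerivAt_ellipticF hk (am k x)).of_local_left_inverse
    (continuous_am hk).continuousAt (one_div_pos.2 hpos).ne'
    (Filter.Eventually.of_forall (ellipticF_am hk))
  simpa [dn, sn] using h

lemma am_zero (hk : k ^ 2 < 1) : am k 0 = 0 := by
  simpa using am_ellipticF hk 0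

lemma am_Ke (hk : k ^ 2 < 1) : am k (Ke k) = Real.pi / 2 := am_ellipticF hk _

lemma integral_ellipticIntegrand_zero_pi (hk : k ^ 2 < 1) :
    ∫ x in (0 : ℝ)..Real.pi, 1 / Real.sqrt (1 - k ^ 2 * Real.sin x ^ 2) = 2 * Ke k := by
  have hi := fun a b => (continuous_ellipticIntegrand hk).intervalIntegrable
    (μ := MeasureTheory.volume) a b
  have h := intervalIntegral.integral_comp_sub_left (a := Real.pi / 2) (b := Real.pi)
    (fun x : ℝ => 1 / Real.sqrt (1 - k ^ 2 * Real.sin x ^ 2)) Real.pi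
  simp only [Real.sin_pi_sub, sub_self, sub_half] at h
  rw [← intervalIntegral.integral_add_adjacent_intervals (hi 0 (Real.pi / 2)) (hi _ Real.pi), h,
    Ke]
  ring

/-- The integrand is `π`-periodic, with integral `2 Ke k` over a period. -/
lemma ellipticF_add_int_mul_pi (hk : k ^ 2 < 1) (φ : ℝ) (j : ℤ) :
    ellipticF k (φ + j * Real.pi) = ellipticF k φ + 2 * j * Ke k := by
  have hi := fun a b => (continuous_ellipticIntegrand hk).intervalIntegrable
    (μ := MeasureTheory.volume) a b
  have hper : Function.Periodic
      (fun x : ℝ => 1 / Real.sqrt (1 - k ^ 2 * Real.sin x ^ 2)) Real.pi := fun x => by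
    simp [Real.sin_add_pi]
  have h := hper.intervalIntegral_add_zsmul_eq j φ hi
  rw [hper.intervalIntegral_add_eq φ 0, zero_add, integral_ellipticIntegrand_zero_pi hk] at h
  simp only [zsmul_eq_mul] at h
  rw [ellipticF, ← intervalIntegral.integral_add_adjacent_intervals (hi 0 φ) (hi φ _), h, ellipticF]
  ring

lemma am_add_int_mul_Ke (hk : k ^ 2 < 1) (x : ℝ) (j : ℤ) :
    am k (x + 2 * j * Ke k) = am k x + j * Real.pi := by
  conv_lhs => rw [← ellipticF_am hk x, ← ellipticF_add_int_mul_pi hk, am_ellipticF hk]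

lemma eq_add_of_am_eq (hk : k ^ 2 < 1) {x y : ℝ} {j : ℤ} (h : am k y = am k x + j * Real.pi) :
    y = x + 2 * j * Ke k := by
  rw [← ellipticF_am hk y, h, ellipticF_add_int_mul_pi hk, ellipticF_am hk]

/-- Bootstrap on `am' = √(1 - k² sin² am)`: the radicand stays positive, so the derivative is as
smooth as `am` itself. -/
lemma contDiff_am (hk : k ^ 2 < 1) : ContDiff ℝ (⊤ : ℕ∞) (am k) := by
  refine contDiff_infty.2 fun n => ?_
  induction n with
  | zero => exact contDiff_zero.2 (continuous_am hk)
  | succ n ih =>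
    push_cast
    refine contDiff_succ_iff_deriv.2
      ⟨fun x => (hasDerivAt_am hk x).differentiableAt, by simp, ?_⟩
    rw [funext fun x => (hasDerivAt_am hk x).deriv]
    simp only [dn, sn]
    exact (contDiff_const.sub (contDiff_const.mul ((Real.contDiff_sin.comp ih).pow 2))).sqrt
      fun x => (one_sub_sq_mul_sin_sq_pos hk _).ne'

lemma Ke_pos (hk : k ^ 2 < 1) : 0 < Ke k := by
  have := strictMono_ellipticF hk Real.pi_div_two_pos
  rwa [ellipticF_zero] at this

/-- The integrand is largest at `π / 2`. This bound later compares the two sides of the period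
lattice. -/
lemma Ke_mul_sqrt_le (hk : k ^ 2 < 1) : Ke k * Real.sqrt (1 - k ^ 2) ≤ Real.pi / 2 := by
  have hpos : 0 < Real.sqrt (1 - k ^ 2) := Real.sqrt_pos.2 (by linarith)
  rw [← le_div_iff₀ hpos]
  have h : Ke k ≤ ∫ _ in (0 : ℝ)..(Real.pi / 2), 1 / Real.sqrt (1 - k ^ 2) := by
    refine intervalIntegral.integral_mono_on Real.pi_div_two_pos.le
      ((continuous_ellipticIntegrand hk).intervalIntegrable _ _) (by simp) fun x _ => ?_
    refine one_div_le_one_div_of_le hpos (Real.sqrt_le_sqrt ?_)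
    nlinarith [Real.sin_sq_le_one x, sq_nonneg k]
  refine h.trans_eq ?_
  rw [intervalIntegral.integral_const, smul_eq_mul]
  ring

/-! ### Algebra and calculus of `sn`, `cn`, `dn`. -/

lemma dn_pos (hk : k ^ 2 < 1) (x : ℝ) : 0 < dn x k :=
  Real.sqrt_pos.2 (one_sub_sq_mul_sin_sq_pos hk _)

lemma dn_sq (hk : k ^ 2 < 1) (x : ℝ) : dn x k ^ 2 = 1 - k ^ 2 * sn x k ^ 2 :=
  Real.sq_sqrt (one_sub_sq_mul_sin_sq_pos hk _).le

lemma cn_sq (x : ℝ) : cn x k ^ 2 = 1 - sn x k ^ 2 := Real.cos_sq' _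

lemma contDiff_sn (hk : k ^ 2 < 1) : ContDiff ℝ (⊤ : ℕ∞) fun x => sn x k :=
  Real.contDiff_sin.comp (contDiff_am hk)

lemma contDiff_cn (hk : k ^ 2 < 1) : ContDiff ℝ (⊤ : ℕ∞) fun x => cn x k :=
  Real.contDiff_cos.comp (contDiff_am hk)

lemma contDiff_dn (hk : k ^ 2 < 1) : ContDiff ℝ (⊤ : ℕ∞) fun x => dn x k :=
  (contDiff_const.sub (contDiff_const.mul ((contDiff_sn hk).pow 2))).sqrt
    fun _ => (one_sub_sq_mul_sin_sq_pos hk _).ne'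

lemma hasDerivAt_sn (hk : k ^ 2 < 1) (x : ℝ) :
    HasDerivAt (fun x => sn x k) (cn x k * dn x k) x :=
  (hasDerivAt_am hk x).sin

lemma hasDerivAt_cn (hk : k ^ 2 < 1) (x : ℝ) :
    HasDerivAt (fun x => cn x k) (-(sn x k * dn x k)) x :=
  (hasDerivAt_am hk x).cos.congr_deriv (by rw [sn]; ring)

lemma hasDerivAt_dn (hk : k ^ 2 < 1) (x : ℝ) :
    HasDerivAt (fun x => dn x k) (-(k ^ 2 * (sn x k * cn x k))) x := by
  have h := ((((hasDerivAt_sn hk x).pow 2).const_mul (k ^ 2)).const_sub 1).sqrt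
    (one_sub_sq_mul_sin_sq_pos hk _).ne'
  refine h.congr_deriv ?_
  have hd : Real.sqrt (1 - k ^ 2 * sn x k ^ 2) = dn x k := rfl
  have := (dn_pos hk x).ne'
  simp only [hd, Pi.pow_apply]
  field_simp
  push_cast
  ring

end Amplitude

/-! ### Partial derivatives -/

section PartialDerivatives

variable {F : Type*} [NormedAddCommGroup F] [NormedSpace ℝ F] {f : ℝ × ℝ → F} {p : ℝ × ℝ} {v : F}

lemma pderivS_eq_of_hasDerivAt (hf : DifferentiableAt ℝ f p)
    (h : HasDerivAt (fun s => f (s, p.2)) v p.1) : pderivS f p = v := by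
  have h1 : HasDerivAt (fun s : ℝ => ((s, p.2) : ℝ × ℝ)) (1, 0) p.1 :=
    (hasDerivAt_id p.1).prodMk (hasDerivAt_const p.1 p.2)
  exact (hf.hasFDerivAt.comp_hasDerivAt p.1 h1).unique h

lemma pderivT_eq_of_hasDerivAt (hf : DifferentiableAt ℝ f p)
    (h : HasDerivAt (fun t => f (p.1, t)) v p.2) : pderivT f p = v := by
  have h1 : HasDerivAt (fun t : ℝ => ((p.1, t) : ℝ × ℝ)) (0, 1) p.2 :=
    (hasDerivAt_const p.2 p.1).prodMk (hasDerivAt_id p.2)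
  exact (hf.hasFDerivAt.comp_hasDerivAt p.2 h1).unique h

lemma fderiv_apply_eq_pderiv (v : ℝ × ℝ) :
    fderiv ℝ f p v = v.1 • pderivS f p + v.2 • pderivT f p := by
  rw [pderivS, pderivT, ← map_smul, ← map_smul, ← map_add]
  simp

lemma pderivS_comp_snd {g g' : ℝ → ℝ} (hg : ∀ t, HasDerivAt g (g' t) t) :
    pderivS (fun p : ℝ × ℝ => g p.2) = 0 := by
  funext p
  exact pderivS_eq_of_hasDerivAt (v := 0) ((hg p.2).differentiableAt.comp p differentiableAt_snd)
    (hasDerivAt_const p.1 (g p.2))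

lemma pderivT_comp_snd {g g' : ℝ → ℝ} (hg : ∀ t, HasDerivAt g (g' t) t) :
    pderivT (fun p : ℝ × ℝ => g p.2) = fun p => g' p.2 := by
  funext p
  exact pderivT_eq_of_hasDerivAt ((hg p.2).differentiableAt.comp p differentiableAt_snd) (hg p.2)

end PartialDerivatives

/-- The Gauss curvature of a conformal metric `g(t) (ds² + dt²)` invariant in the variable `s`. -/
lemma metricGauss_conformal {g g' g'' : ℝ → ℝ} (hg : ∀ t, HasDerivAt g (g' t) t)
    (hg' : ∀ t, HasDerivAt g' (g'' t) t) (p : ℝ × ℝ) (h0 : g p.2 ≠ 0) :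
    metricGauss (fun p => g p.2) (fun _ => 0) (fun p => g p.2) p =
      (g' p.2 ^ 2 - g p.2 * g'' p.2) / (2 * g p.2 ^ 3) := by
  have hz : ∀ t : ℝ, HasDerivAt (fun _ : ℝ => (0 : ℝ)) 0 t := fun t => hasDerivAt_const _ _
  have hS0 : pderivS (fun _ : ℝ × ℝ => (0 : ℝ)) = 0 := pderivS_comp_snd hz
  have hT0 : pderivT (fun _ : ℝ × ℝ => (0 : ℝ)) = fun _ => 0 := pderivT_comp_snd hz
  have hS0' : pderivS (0 : ℝ × ℝ → ℝ) = 0 := hS0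
  simp only [metricGauss, pderivT_comp_snd hg, pderivS_comp_snd hg, pderivT_comp_snd hg', hS0, hT0,
    hS0', Matrix.det_fin_three, Pi.zero_apply]
  simp
  field_simp
  ring

/-! ### Waves in `ℂ³` -/

lemma hasDerivAt_C3 {f : ℝ → C3} {v : C3} {x : ℝ} (h : ∀ j, HasDerivAt (fun y => f y j) (v j) x) :
    HasDerivAt f v x :=
  (PiLp.continuousLinearEquiv 2 ℝ fun _ : Fin 3 => ℂ).symm.hasFDerivAt.comp_hasDerivAt x
    (hasDerivAt_pi.2 h)

/-- The map with components `e^{i lⱼ s} cⱼ fⱼ(t)`. -/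
def wave (l : Fin 3 → ℝ) (c : Fin 3 → ℂ) (f : Fin 3 → ℝ → ℝ) (p : ℝ × ℝ) : C3 :=
  WithLp.toLp 2 fun j => Complex.exp (Complex.I * (l j : ℂ) * (p.1 : ℂ)) * (c j * (f j p.2 : ℂ))

section Wave

variable {l : Fin 3 → ℝ} {c d : Fin 3 → ℂ} {f f' g : Fin 3 → ℝ → ℝ}

lemma contDiff_wave (hf : ∀ j, ContDiff ℝ (⊤ : ℕ∞) (f j)) :
    ContDiff ℝ (⊤ : ℕ∞) (wave l c f) := by
  refine (contDiff_piLp 2).2 ?_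
  intro j
  have h1 : ContDiff ℝ (⊤ : ℕ∞) fun p : ℝ × ℝ => ((p.1 : ℝ) : ℂ) :=
    Complex.ofRealCLM.contDiff.comp contDiff_fst
  have h2 : ContDiff ℝ (⊤ : ℕ∞) fun p : ℝ × ℝ => ((f j p.2 : ℝ) : ℂ) :=
    Complex.ofRealCLM.contDiff.comp ((hf j).comp contDiff_snd)
  exact (contDiff_const.mul h1).cexp.mul (contDiff_const.mul h2)

lemma differentiable_wave (hf : ∀ j t, HasDerivAt (f j) (f' j t) t) :
    Differentiable ℝ (wave l c f) := by
  refine (differentiable_piLp 2).2 ?_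
  intro j
  have h1 : Differentiable ℝ fun p : ℝ × ℝ => ((p.1 : ℝ) : ℂ) :=
    Complex.ofRealCLM.differentiable.comp differentiable_fst
  have h2 : Differentiable ℝ fun p : ℝ × ℝ => ((f j p.2 : ℝ) : ℂ) :=
    Complex.ofRealCLM.differentiable.comp
      (Differentiable.comp (fun t => (hf j t).differentiableAt) differentiable_snd)
  exact (h1.const_mul _).cexp.mul (h2.const_mul _)

lemma pderivS_wave (hf : ∀ j t, HasDerivAt (f j) (f' j t) t) :
    pderivS (wave l c f) = wave l (fun j => Complex.I * l j * c j) f := by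
  funext p
  refine pderivS_eq_of_hasDerivAt (differentiable_wave hf p) ?_
  refine hasDerivAt_C3 fun j => ?_
  have h := ((((hasDerivAt_id p.1).ofReal_comp).const_mul (Complex.I * (l j : ℂ))).cexp).mul_const
    (c j * (f j p.2 : ℂ))
  refine h.congr_deriv ?_
  simp [wave]
  ring

lemma pderivT_wave (hf : ∀ j t, HasDerivAt (f j) (f' j t) t) :
    pderivT (wave l c f) = wave l c f' := by
  funext p
  refine pderivT_eq_of_hasDerivAt (differentiable_wave hf p) ?_
  refine hasDerivAt_C3 fun j => ?_
  have h := ((hf j p.2).ofReal_comp.const_mul (c j)).const_mul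
    (Complex.exp (Complex.I * (l j : ℂ) * (p.1 : ℂ)))
  refine h.congr_deriv ?_
  simp [wave]

lemma conj_exp_I_mul_self (a b : ℝ) :
    (starRingEnd ℂ) (Complex.exp (Complex.I * (a : ℂ) * (b : ℂ))) *
      Complex.exp (Complex.I * (a : ℂ) * (b : ℂ)) = 1 := by
  rw [← Complex.exp_conj, ← Complex.exp_add]
  simp

/-- Both waves have the same real frequencies, so the exponentials cancel and `s` disappears. -/
lemma inner_wave (p : ℝ × ℝ) :
    inner ℂ (wave l c f p) (wave l d g p) =
      ∑ j, (starRingEnd ℂ) (c j) * d j * ((f j p.2 * g j p.2 : ℝ) : ℂ) := by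
  rw [PiLp.inner_apply]
  refine Finset.sum_congr rfl fun j _ => ?_
  have h := conj_exp_I_mul_self (l j) p.1
  simp only [wave, RCLike.inner_apply, map_mul, Complex.conj_ofReal, Complex.ofReal_mul]
  linear_combination ((starRingEnd ℂ) (c j) * d j * f j p.2 * g j p.2) * h

end Wave

/-! ### First-order geometry of `u_{α,0}` -/

section Immersion

variable {α : ℝ}

lemma kOf_sq (h0 : 0 < α) (h1 : α ≤ 1) : kOf α ^ 2 = (1 - α ^ 2) / (1 + 2 * α) :=
  Real.sq_sqrt (div_nonneg (by nlinarith) (by linarith))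

lemma kOf_sq_lt_one (h0 : 0 < α) (h1 : α ≤ 1) : kOf α ^ 2 < 1 := by
  rw [kOf_sq h0 h1, div_lt_one (by linarith)]
  nlinarith

lemma rOf_sq (h0 : 0 < α) : rOf α ^ 2 = 1 + 2 * α := Real.sq_sqrt (by linarith)

lemma rOf_pos (h0 : 0 < α) : 0 < rOf α := Real.sqrt_pos.2 (by linarith)

/-- The frequencies `1, α, -1 - α` of the one-parameter group acting on `u_{α,0}`. -/
def freq (α : ℝ) : Fin 3 → ℝ := ![1, α, -1 - α]

/-- The constant phases of `u_{α,0}`. -/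
def phase (θ : ℝ) : Fin 3 → ℂ :=
  ![Complex.exp (-Complex.I * ((θ : ℂ) + (Real.pi : ℂ) / 2)), 1, 1]

/-- The profile curve `(R₁, R₂, R₃)`. -/
def profile (α : ℝ) : Fin 3 → ℝ → ℝ := ![R1 α, R2 α, R3 α]

/-- The derivative of the profile curve. -/
def profileDeriv (α : ℝ) : Fin 3 → ℝ → ℝ :=
  ![fun t => -(√((1 + α) / (2 + α)) * rOf α * (sn (rOf α * t) (kOf α) * dn (rOf α * t) (kOf α))),
    fun t => √((1 + α) / (1 + 2 * α)) * rOf α * (cn (rOf α * t) (kOf α) * dn (rOf α * t) (kOf α)),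
    fun t => -(√(1 / (2 + α)) * rOf α * kOf α ^ 2 *
      (sn (rOf α * t) (kOf α) * cn (rOf α * t) (kOf α)))]

/-- The conformal factor of the metric induced by `u_{α,0}`. -/
def conformalFactor (α t : ℝ) : ℝ := 1 + α - (1 - α ^ 2) * sn (rOf α * t) (kOf α) ^ 2

lemma sn_sq_le_one (x k : ℝ) : sn x k ^ 2 ≤ 1 := Real.sin_sq_le_one _

lemma le_conformalFactor (h0 : 0 < α) (h1 : α ≤ 1) (t : ℝ) :
    α * (1 + α) ≤ conformalFactor α t := by
  have h : 0 ≤ 1 - α ^ 2 := by nlinarith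
  rw [conformalFactor]
  nlinarith [mul_le_mul_of_nonneg_left (sn_sq_le_one (rOf α * t) (kOf α)) h]

lemma conformalFactor_le (h0 : 0 < α) (h1 : α ≤ 1) (t : ℝ) : conformalFactor α t ≤ 1 + α := by
  have h : 0 ≤ 1 - α ^ 2 := by nlinarith
  rw [conformalFactor]
  linarith [mul_nonneg h (sq_nonneg (sn (rOf α * t) (kOf α)))]

lemma conformalFactor_pos (h0 : 0 < α) (h1 : α ≤ 1) (t : ℝ) : 0 < conformalFactor α t :=
  lt_of_lt_of_le (by positivity) (le_conformalFactor h0 h1 t)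

lemma uZero_eq_wave (α θ : ℝ) : uZero α θ = wave (freq α) (phase θ) (profile α) := by
  funext p
  ext j
  fin_cases j <;> simp [uZero, wave, freq, phase, profile]

lemma conj_phase_mul_self (θ : ℝ) (j : Fin 3) :
    (starRingEnd ℂ) (phase θ j) * phase θ j = 1 := by
  fin_cases j
  · simp only [phase, Fin.zero_eta, Matrix.cons_val_zero]
    rw [← Complex.exp_conj, ← Complex.exp_add]
    simp only [map_mul, map_neg, map_add, map_div₀, Complex.conj_I, Complex.conj_ofReal,
      Complex.conj_ofNat]
    rw [← Complex.exp_zero]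
    congr 1
    ring
  · simp [phase]
  · simp [phase]

lemma hasDerivAt_comp_rOf_mul {f : ℝ → ℝ} {f' t : ℝ} (h : HasDerivAt f f' (rOf α * t)) :
    HasDerivAt (fun t => f (rOf α * t)) (f' * rOf α) t :=
  h.comp t (by simpa using (hasDerivAt_id t).const_mul (rOf α))

lemma hasDerivAt_profile (h0 : 0 < α) (h1 : α ≤ 1) (j : Fin 3) (t : ℝ) :
    HasDerivAt (profile α j) (profileDeriv α j t) t := by
  have hk := kOf_sq_lt_one h0 h1
  fin_cases j
  · exact ((hasDerivAt_comp_rOf_mul (hasDerivAt_cn hk _)).const_mul _).congr_deriv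
      (by simp [profileDeriv]; ring)
  · exact ((hasDerivAt_comp_rOf_mul (hasDerivAt_sn hk _)).const_mul _).congr_deriv
      (by simp [profileDeriv]; ring)
  · exact ((hasDerivAt_comp_rOf_mul (hasDerivAt_dn hk _)).const_mul _).congr_deriv
      (by simp [profileDeriv]; ring)

/-- The potential `2e` is the same for all three components, and `λⱼ²` will cancel against the
second `s`-derivative. With `sn`, `cn`, `dn` as symbols, each case is polynomial algebra modulo
their quadratic relations, `r² = 1 + 2α` and `r²k² = 1 - α²`. -/
lemma hasDerivAt_profileDeriv (h0 : 0 < α) (h1 : α ≤ 1) (j : Fin 3) (t : ℝ) :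
    HasDerivAt (profileDeriv α j) ((freq α j ^ 2 - 2 * conformalFactor α t) * profile α j t) t := by
  have hk := kOf_sq_lt_one h0 h1
  have hr := rOf_sq h0
  have hrk : rOf α ^ 2 * kOf α ^ 2 = 1 - α ^ 2 := by
    rw [hr, kOf_sq h0 h1]; field_simp
  have hC := cn_sq (k := kOf α) (rOf α * t)
  have hD := dn_sq hk (rOf α * t)
  have ds := hasDerivAt_comp_rOf_mul (hasDerivAt_sn hk (rOf α * t))
  have dc := hasDerivAt_comp_rOf_mul (hasDerivAt_cn hk (rOf α * t))
  have dd := hasDerivAt_comp_rOf_mul (hasDerivAt_dn hk (rOf α * t))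
  fin_cases j
  · refine ((ds.mul dd).const_mul (√((1 + α) / (2 + α)) * rOf α)).neg.congr_deriv ?_
    simp only [freq, profile, R1, conformalFactor, Fin.zero_eta, Matrix.cons_val_zero]
    generalize sn (rOf α * t) (kOf α) = S at *
    generalize cn (rOf α * t) (kOf α) = C at *
    generalize dn (rOf α * t) (kOf α) = D at *
    generalize √((1 + α) / (2 + α)) = a
    linear_combination (-a * rOf α ^ 2 * C) * hD + (2 * a * C * S ^ 2) * hrk - a * C * hr
  · refine ((dc.mul dd).const_mul (√((1 + α) / (1 + 2 * α)) * rOf α)).congr_deriv ?_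
    simp only [freq, profile, R2, conformalFactor, Fin.mk_one, Matrix.cons_val_one,
      Matrix.cons_val_zero]
    generalize sn (rOf α * t) (kOf α) = S at *
    generalize cn (rOf α * t) (kOf α) = C at *
    generalize dn (rOf α * t) (kOf α) = D at *
    generalize √((1 + α) / (1 + 2 * α)) = a
    linear_combination (-a * rOf α ^ 2 * S) * hD - a * rOf α ^ 2 * kOf α ^ 2 * S * hC
      + a * S * (2 * S ^ 2 - 1) * hrk - a * S * hr
  · refine ((ds.mul dc).const_mul (√(1 / (2 + α)) * rOf α * kOf α ^ 2)).neg.congr_deriv ?_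
    simp only [freq, profile, R3, conformalFactor, Fin.reduceFinMk, Matrix.cons_val]
    generalize sn (rOf α * t) (kOf α) = S at *
    generalize cn (rOf α * t) (kOf α) = C at *
    generalize dn (rOf α * t) (kOf α) = D at *
    generalize √(1 / (2 + α)) = a
    linear_combination (-a * rOf α ^ 2 * kOf α ^ 2 * D) * hC + a * D * (2 * S ^ 2 - 1) * hrk

lemma contDiff_profile (h0 : 0 < α) (h1 : α ≤ 1) (j : Fin 3) :
    ContDiff ℝ (⊤ : ℕ∞) (profile α j) := by
  have hk := kOf_sq_lt_one h0 h1
  have hl : ContDiff ℝ (⊤ : ℕ∞) fun t : ℝ => rOf α * t := contDiff_const.mul contDiff_id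
  fin_cases j
  · exact contDiff_const.mul ((contDiff_cn hk).comp hl)
  · exact contDiff_const.mul ((contDiff_sn hk).comp hl)
  · exact contDiff_const.mul ((contDiff_dn hk).comp hl)

/-! ### Quadratic identities of the profile curve. -/

lemma R1_sq (h0 : 0 < α) (t : ℝ) :
    R1 α t ^ 2 = (1 + α) / (2 + α) * (1 - sn (rOf α * t) (kOf α) ^ 2) := by
  rw [R1, mul_pow, Real.sq_sqrt (by positivity), cn_sq]

lemma R2_sq (h0 : 0 < α) (t : ℝ) :
    R2 α t ^ 2 = (1 + α) / (1 + 2 * α) * sn (rOf α * t) (kOf α) ^ 2 := by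
  rw [R2, mul_pow, Real.sq_sqrt (by positivity)]

lemma R3_sq (h0 : 0 < α) (h1 : α ≤ 1) (t : ℝ) :
    R3 α t ^ 2 =
      1 / (2 + α) * (1 - (1 - α ^ 2) / (1 + 2 * α) * sn (rOf α * t) (kOf α) ^ 2) := by
  rw [R3, mul_pow, Real.sq_sqrt (by positivity), dn_sq (kOf_sq_lt_one h0 h1), kOf_sq h0 h1]

lemma sum_profile_sq (h0 : 0 < α) (h1 : α ≤ 1) (t : ℝ) :
    R1 α t ^ 2 + R2 α t ^ 2 + R3 α t ^ 2 = 1 := by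
  rw [R1_sq h0, R2_sq h0, R3_sq h0 h1]
  field_simp
  ring

/-- This is the Legendrian condition in the direction `s`; it also prevents `R1` and `R2` from
vanishing together. -/
lemma sum_freq_mul_profile_sq (h0 : 0 < α) (h1 : α ≤ 1) (t : ℝ) :
    R1 α t ^ 2 + α * R2 α t ^ 2 + (-1 - α) * R3 α t ^ 2 = 0 := by
  rw [R1_sq h0, R2_sq h0, R3_sq h0 h1]
  field_simp
  ring

lemma sum_freq_sq_mul_profile_sq (h0 : 0 < α) (h1 : α ≤ 1) (t : ℝ) :
    R1 α t ^ 2 + α ^ 2 * R2 α t ^ 2 + (-1 - α) ^ 2 * R3 α t ^ 2 = conformalFactor α t := by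
  rw [R1_sq h0, R2_sq h0, R3_sq h0 h1, conformalFactor]
  field_simp
  ring

lemma sum_profileDeriv_sq (h0 : 0 < α) (h1 : α ≤ 1) (t : ℝ) :
    profileDeriv α 0 t ^ 2 + profileDeriv α 1 t ^ 2 + profileDeriv α 2 t ^ 2 =
      conformalFactor α t := by
  have hk := kOf_sq_lt_one h0 h1
  simp only [profileDeriv, Matrix.cons_val]
  simp only [neg_sq, mul_pow, cn_sq, dn_sq hk, rOf_sq h0]
  rw [Real.sq_sqrt (by positivity), Real.sq_sqrt (by positivity), Real.sq_sqrt (by positivity),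
    kOf_sq h0 h1, conformalFactor]
  field_simp
  ring

/-! ### Induced metric, minimality and curvature. -/

variable (θ : ℝ)

lemma pderivS_uZero (h0 : 0 < α) (h1 : α ≤ 1) :
    pderivS (uZero α θ) =
      wave (freq α) (fun j => Complex.I * freq α j * phase θ j) (profile α) := by
  rw [uZero_eq_wave, pderivS_wave (hasDerivAt_profile h0 h1)]

lemma pderivT_uZero (h0 : 0 < α) (h1 : α ≤ 1) :
    pderivT (uZero α θ) = wave (freq α) (phase θ) (profileDeriv α) := by
  rw [uZero_eq_wave, pderivT_wave (hasDerivAt_profile h0 h1)]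

lemma inner_uZero_self (h0 : 0 < α) (h1 : α ≤ 1) (p : ℝ × ℝ) :
    inner ℂ (uZero α θ p) (uZero α θ p) = 1 := by
  rw [uZero_eq_wave, inner_wave]
  simp only [conj_phase_mul_self, Fin.sum_univ_three, one_mul]
  norm_cast
  simpa [profile, pow_two] using sum_profile_sq h0 h1 p.2

lemma inner_uZero_pderivS (h0 : 0 < α) (h1 : α ≤ 1) (p : ℝ × ℝ) :
    inner ℂ (uZero α θ p) (pderivS (uZero α θ) p) = 0 := by
  rw [pderivS_uZero θ h0 h1, uZero_eq_wave, inner_wave]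
  have h : ∀ j, (starRingEnd ℂ) (phase θ j) * (Complex.I * freq α j * phase θ j) =
      Complex.I * freq α j := fun j => by
    linear_combination (Complex.I * freq α j) * conj_phase_mul_self θ j
  have h2 : ((R1 α p.2 ^ 2 + α * R2 α p.2 ^ 2 + (-1 - α) * R3 α p.2 ^ 2 : ℝ) : ℂ) = 0 := by
    rw [sum_freq_mul_profile_sq h0 h1]; simp
  simp only [h]
  simp only [Fin.sum_univ_three, freq, profile, Matrix.cons_val]
  push_cast at h2 ⊢
  linear_combination Complex.I * h2

lemma inner_uZero_pderivT (h0 : 0 < α) (h1 : α ≤ 1) (p : ℝ × ℝ) :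
    (inner ℂ (uZero α θ p) (pderivT (uZero α θ) p)).im = 0 := by
  rw [pderivT_uZero θ h0 h1, uZero_eq_wave, inner_wave]
  simp only [conj_phase_mul_self, Fin.sum_univ_three, one_mul]
  norm_cast

lemma metE_uZero (h0 : 0 < α) (h1 : α ≤ 1) :
    metE (uZero α θ) = fun p => conformalFactor α p.2 := by
  funext p
  rw [metE, dot3, pderivS_uZero θ h0 h1, inner_wave]
  have h : ∀ j, (starRingEnd ℂ) (Complex.I * freq α j * phase θ j) *
      (Complex.I * freq α j * phase θ j) = ((freq α j ^ 2 : ℝ) : ℂ) := fun j => by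
    simp only [map_mul, Complex.conj_I, Complex.conj_ofReal]
    push_cast
    linear_combination (-Complex.I ^ 2 * freq α j ^ 2) * conj_phase_mul_self θ j
      - (freq α j : ℂ) ^ 2 * Complex.I_sq
  simp only [h]
  simp only [Fin.sum_univ_three, freq, profile, Matrix.cons_val]
  simp only [← Complex.ofReal_mul, ← Complex.ofReal_add, Complex.ofReal_re]
  rw [← sum_freq_sq_mul_profile_sq h0 h1]
  ring

lemma metF_uZero (h0 : 0 < α) (h1 : α ≤ 1) : metF (uZero α θ) = fun _ => 0 := by
  funext p
  rw [metF, dot3, pderivS_uZero θ h0 h1, pderivT_uZero θ h0 h1, inner_wave]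
  have h : ∀ j, (starRingEnd ℂ) (Complex.I * freq α j * phase θ j) * phase θ j =
      -Complex.I * freq α j := fun j => by
    simp only [map_mul, Complex.conj_I, Complex.conj_ofReal]
    linear_combination (-Complex.I * freq α j) * conj_phase_mul_self θ j
  simp only [h]
  simp [Fin.sum_univ_three]

lemma metG_uZero (h0 : 0 < α) (h1 : α ≤ 1) :
    metG (uZero α θ) = fun p => conformalFactor α p.2 := by
  funext p
  rw [metG, dot3, pderivT_uZero θ h0 h1, inner_wave]
  simp only [conj_phase_mul_self, Fin.sum_univ_three, one_mul]
  norm_cast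
  rw [← sum_profileDeriv_sq h0 h1]
  ring

/-- The immersion is an eigenfunction of its Laplacian, up to the conformal factor. -/
lemma pderiv_sum_uZero (h0 : 0 < α) (h1 : α ≤ 1) (p : ℝ × ℝ) :
    pderivS (pderivS (uZero α θ)) p + pderivT (pderivT (uZero α θ)) p =
      (-2 * conformalFactor α p.2) • uZero α θ p := by
  rw [pderivS_uZero θ h0 h1, pderivT_uZero θ h0 h1, pderivS_wave (hasDerivAt_profile h0 h1),
    pderivT_wave (hasDerivAt_profileDeriv h0 h1), uZero_eq_wave]
  ext j
  simp only [wave, PiLp.add_apply, PiLp.smul_apply, Complex.real_smul]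
  push_cast
  linear_combination (Complex.exp (Complex.I * freq α j * p.1) * freq α j ^ 2 * phase θ j *
    profile α j p.2) * Complex.I_sq

lemma isMinimalLegendrianImmersion_uZero (h0 : 0 < α) (h1 : α ≤ 1) :
    IsMinimalLegendrianImmersion (uZero α θ) where
  smooth := by
    rw [uZero_eq_wave]
    exact contDiff_wave (contDiff_profile h0 h1)
  mem_sphere p := by
    have h := congrArg Complex.re (inner_uZero_self θ h0 h1 p)
    have h' : ‖uZero α θ p‖ ^ 2 = 1 := (inner_self_eq_norm_sq (𝕜 := ℂ) _).symm.trans h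
    rw [mem_sphere_zero_iff_norm]
    exact (pow_eq_one_iff_of_nonneg (norm_nonneg _) two_ne_zero).1 h'
  immersion p := by
    rw [injective_iff_map_eq_zero]
    intro v hv
    rw [fderiv_apply_eq_pderiv] at hv
    have hE := congrFun (metE_uZero θ h0 h1) p
    have hF := congrFun (metF_uZero θ h0 h1) p
    have hG := congrFun (metG_uZero θ h0 h1) p
    have hpos := conformalFactor_pos h0 h1 p.2
    simp only [metE, metF, metG, dot3] at hE hF hG
    -- Pairing a kernel vector with the orthogonal derivatives of squared length `e > 0` isolates
    -- its two coordinates.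
    have e1 : dot3 (pderivS (uZero α θ) p)
        (v.1 • pderivS (uZero α θ) p + v.2 • pderivT (uZero α θ) p) = 0 := by simp [hv, dot3]
    have e2 : dot3 (v.1 • pderivS (uZero α θ) p + v.2 • pderivT (uZero α θ) p)
        (pderivT (uZero α θ) p) = 0 := by simp [hv, dot3]
    simp only [dot3, inner_add_left, inner_add_right, inner_smul_left_eq_smul,
      inner_smul_right_eq_smul, Complex.add_re, Complex.smul_re, hE, hF, hG, smul_eq_mul] at e1 e2
    ext
    · simpa [hpos.ne'] using e1
    · simpa [hpos.ne'] using e2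
  legendrian p v := by
    rw [fderiv_apply_eq_pderiv, omega3, inner_add_right, inner_smul_right_eq_smul,
      inner_smul_right_eq_smul, Complex.add_im, Complex.smul_im, Complex.smul_im,
      inner_uZero_pderivS θ h0 h1, inner_uZero_pderivT θ h0 h1]
    simp
  minimal p := by
    simp only [metE_uZero θ h0 h1, metF_uZero θ h0 h1, metG_uZero θ h0 h1, mul_zero, zero_smul,
      sub_zero]
    -- Since `F = 0` and `E = G`, the trace of the Hessian is a multiple of the flat Laplacian,
    -- hence of the position vector.
    rw [← smul_add, pderiv_sum_uZero θ h0 h1]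
    exact Submodule.smul_mem _ _ (Submodule.smul_mem _ _ (Submodule.subset_span (by simp)))

lemma gaussCurvature_uZero (h0 : 0 < α) (h1 : α ≤ 1) (p : ℝ × ℝ) :
    gaussCurvature (uZero α θ) p =
      1 - 2 * (α * (1 + α)) ^ 2 / conformalFactor α p.2 ^ 3 := by
  have hk := kOf_sq_lt_one h0 h1
  have ds := fun t => hasDerivAt_comp_rOf_mul (hasDerivAt_sn hk (rOf α * t))
  have dc := fun t => hasDerivAt_comp_rOf_mul (hasDerivAt_cn hk (rOf α * t))
  have dd := fun t => hasDerivAt_comp_rOf_mul (hasDerivAt_dn hk (rOf α * t))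
  have hg : ∀ t, HasDerivAt (conformalFactor α) (-2 * (1 - α ^ 2) * rOf α *
      (sn (rOf α * t) (kOf α) * (cn (rOf α * t) (kOf α) * dn (rOf α * t) (kOf α)))) t := fun t =>
    ((((ds t).pow 2).const_mul (1 - α ^ 2)).const_sub (1 + α)).congr_deriv (by push_cast; ring)
  have hg' := fun t => ((ds t).mul ((dc t).mul (dd t))).const_mul (-2 * (1 - α ^ 2) * rOf α)
  have hpos := conformalFactor_pos h0 h1 p.2
  have hr := rOf_sq h0
  have hrk : rOf α ^ 2 * kOf α ^ 2 = 1 - α ^ 2 := by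
    rw [hr, kOf_sq h0 h1]; field_simp
  have hC := cn_sq (k := kOf α) (rOf α * p.2)
  have hD := dn_sq hk (rOf α * p.2)
  have hE : conformalFactor α p.2 = 1 + α - (1 - α ^ 2) * sn (rOf α * p.2) (kOf α) ^ 2 := rfl
  rw [gaussCurvature, metE_uZero θ h0 h1, metF_uZero θ h0 h1, metG_uZero θ h0 h1,
    metricGauss_conformal hg hg' p hpos.ne', div_eq_iff (by positivity)]
  simp only [Pi.mul_apply]
  generalize conformalFactor α p.2 = E at *
  generalize sn (rOf α * p.2) (kOf α) = S at *
  generalize cn (rOf α * p.2) (kOf α) = C at *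
  generalize dn (rOf α * p.2) (kOf α) = D at *
  -- The modulus and `r` enter the numerator only through `r²D²` and `r²k²`; replacing these leaves
  -- a polynomial identity in `α` and `S`.
  have hrD : rOf α ^ 2 * D ^ 2 = 1 + 2 * α - (1 - α ^ 2) * S ^ 2 := by
    rw [hD]; linear_combination hr - S ^ 2 * hrk
  have hE3 : (1 - 2 * (α * (1 + α)) ^ 2 / E ^ 3) * (2 * E ^ 3) =
      2 * E ^ 3 - 4 * (α * (1 + α)) ^ 2 := by field_simp; ring
  rw [hE3]
  have key : 4 * (1 - α ^ 2) ^ 2 * S ^ 2 * C ^ 2 * (rOf α ^ 2 * D ^ 2) +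
      2 * (1 - α ^ 2) * E * (C ^ 2 * (rOf α ^ 2 * D ^ 2) - S ^ 2 * (rOf α ^ 2 * D ^ 2) -
        S ^ 2 * C ^ 2 * (rOf α ^ 2 * kOf α ^ 2)) = 2 * E ^ 3 - 4 * (α * (1 + α)) ^ 2 := by
    rw [hrD, hrk, hC, hE]
    ring
  rw [← key]
  ring

end Immersion

/-! ### Lattices in the plane -/

section Lattice

variable {L : AddSubgroup (ℝ × ℝ)} {A B : ℝ}

lemma isLatticeBasis_rectangular (hA : 0 < A) (hB : 0 < B)
    (hL : ∀ ω, ω ∈ L ↔ ∃ l j : ℤ, ω = (l * A, j * B) ∧ Even l ∧ Even j) :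
    IsLatticeBasis L (2 * A, 0) (0, 2 * B) := by
  constructor
  · rw [LinearIndependent.pair_iff]
    intro s t h
    simpa [hA.ne', hB.ne'] using h
  · ext ω
    rw [AddSubgroup.mem_closure_pair, hL]
    constructor
    · rintro ⟨c, d, rfl⟩
      exact ⟨2 * c, 2 * d, by ext <;> simp <;> ring, even_two_mul c, even_two_mul d⟩
    · rintro ⟨l, j, rfl, ⟨c, rfl⟩, ⟨d, rfl⟩⟩
      exact ⟨c, d, by ext <;> simp <;> ring⟩

lemma isRectangular_of_even (hA : 0 < A) (hB : 0 < B)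
    (hL : ∀ ω, ω ∈ L ↔ ∃ l j : ℤ, ω = (l * A, j * B) ∧ Even l ∧ Even j) :
    IsRectangular L :=
  ⟨_, _, isLatticeBasis_rectangular hA hB hL, by simp⟩

lemma isLatticeBasis_rhombic (hA : 0 < A) (hB : 0 < B)
    (hL : ∀ ω, ω ∈ L ↔ ∃ l j : ℤ, ω = (l * A, j * B) ∧ (Even l ↔ Even j)) :
    IsLatticeBasis L (2 * A, 0) (A, B) := by
  constructor
  · rw [LinearIndependent.pair_iff]
    intro s t h
    have h2 : t = 0 := by simpa [hB.ne'] using congrArg Prod.snd h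
    subst h2
    simpa [hA.ne'] using h
  · ext ω
    rw [AddSubgroup.mem_closure_pair, hL]
    constructor
    · rintro ⟨c, d, rfl⟩
      exact ⟨2 * c + d, d, by ext <;> simp; ring, by simp [Int.even_add]⟩
    · rintro ⟨l, j, rfl, h⟩
      -- Equal parity makes `l - j` even, and its half is the coefficient of `(2A, 0)`.
      obtain ⟨c, hc⟩ := Int.even_sub.2 h
      obtain rfl : l = c + c + j := by omega
      exact ⟨c, j, by ext <;> simp; ring⟩

/-- The lattice generated by `(A, B)` and `(A, -B)` is not rectangular, unless it is square. -/
lemma not_isRectangular_rhombic (hB : 0 < B) (hBA : B < A)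
    (hL : ∀ ω, ω ∈ L ↔ ∃ l j : ℤ, ω = (l * A, j * B) ∧ (Even l ↔ Even j)) :
    ¬ IsRectangular L := by
  rintro ⟨v, w, ⟨-, hcl⟩, horth⟩
  have hA : 0 < A := hB.trans hBA
  have hv : v ∈ L := hcl ▸ AddSubgroup.subset_closure (by simp)
  have hw : w ∈ L := hcl ▸ AddSubgroup.subset_closure (by simp)
  obtain ⟨l₁, j₁, rfl, e₁⟩ := (hL v).1 hv
  obtain ⟨l₂, j₂, rfl, e₂⟩ := (hL w).1 hw
  -- The lattice vectors `(2, 0)` and `(1, 1)`, in units of `A` and `B`, have determinant `2`, so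
  -- the determinant of the basis `v, w` divides `2`.
  have hx : ((2 : ℤ) * A, (0 : ℤ) * B) ∈ L := (hL _).2 ⟨2, 0, by simp, by simp⟩
  have hy : ((1 : ℤ) * A, (1 : ℤ) * B) ∈ L := (hL _).2 ⟨1, 1, by simp, by simp⟩
  rw [← hcl, AddSubgroup.mem_closure_pair] at hx hy
  obtain ⟨a, b, hab⟩ := hx
  obtain ⟨c, d, hcd⟩ := hy
  have key : ∀ {x y z x' y' : ℤ} {C : ℝ}, 0 < C →
      x • ((x' : ℝ) * C) + y • ((y' : ℝ) * C) = (z : ℝ) * C → x * x' + y * y' = z := by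
    intro x y z x' y' C hC h
    have h' : ((x * x' + y * y' : ℤ) : ℝ) * C = (z : ℝ) * C := by
      rw [← h]; push_cast; simp only [zsmul_eq_mul]; ring
    exact_mod_cast mul_right_cancel₀ hC.ne' h'
  have h1 : a * l₁ + b * l₂ = 2 := key hA (congrArg Prod.fst hab)
  have h2 : a * j₁ + b * j₂ = 0 := key hB (congrArg Prod.snd hab)
  have h3 : c * l₁ + d * l₂ = 1 := key hA (congrArg Prod.fst hcd)
  have h4 : c * j₁ + d * j₂ = 1 := key hB (congrArg Prod.snd hcd)
  have hdet : (a * l₁ + b * l₂) * (c * j₁ + d * j₂) - (a * j₁ + b * j₂) * (c * l₁ + d * l₂) = 2 := by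
    rw [h1, h2, h3, h4]; norm_num
  have hdvd : l₁ * j₂ - l₂ * j₁ ∣ 2 := ⟨a * d - b * c, by rw [← hdet]; ring⟩
  -- The parity condition makes the determinant even, so it is `±2`.
  have heven : Even (l₁ * j₂ - l₂ * j₁) := by
    rw [Int.even_sub, Int.even_mul, Int.even_mul]; tauto
  have horth' : ((l₁ * l₂ : ℤ) : ℝ) * A ^ 2 = -(((j₁ * j₂ : ℤ) : ℝ) * B ^ 2) := by
    push_cast; linarith
  have hD : l₁ * j₂ - l₂ * j₁ = 2 ∨ l₁ * j₂ - l₂ * j₁ = -2 := by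
    have := Int.le_of_dvd two_pos hdvd
    have := Int.le_of_dvd two_pos (neg_dvd.2 hdvd)
    obtain ⟨e, he⟩ := heven
    have : l₁ * j₂ - l₂ * j₁ ≠ 0 := fun h => by simp [h] at hdvd
    omega
  -- Orthogonality gives `l₁l₂` and `j₁j₂` opposite signs.
  have hle : (l₁ * l₂) * (j₁ * j₂) ≤ 0 := by
    have : (((l₁ * l₂) * (j₁ * j₂) : ℤ) : ℝ) ≤ 0 := by
      have h := congrArg (· * ((j₁ * j₂ : ℤ) : ℝ)) horth'
      rw [Int.cast_mul]
      by_contra! hpos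
      have h5 := mul_pos hpos (pow_pos hA 2)
      nlinarith [mul_nonneg (sq_nonneg ((j₁ * j₂ : ℤ) : ℝ)) (sq_nonneg B)]
    exact_mod_cast this
  by_cases hz : (l₁ * l₂) * (j₁ * j₂) = 0
  · have hz' : l₁ * l₂ = 0 ∧ j₁ * j₂ = 0 := by
      rcases mul_eq_zero.1 hz with h | h
      · refine ⟨h, ?_⟩
        rw [h] at horth'
        have : ((j₁ * j₂ : ℤ) : ℝ) = 0 := by simpa [hB.ne'] using horth'
        exact_mod_cast this
      · refine ⟨?_, h⟩
        rw [h] at horth'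
        have : ((l₁ * l₂ : ℤ) : ℝ) = 0 := by simpa [hA.ne'] using horth'
        exact_mod_cast this
    -- Here both vectors lie on the axes, so their coefficients are even and the determinant is a
    -- multiple of `4`.
    have four : ∀ x y : ℤ, Even x → Even y → x * y ≠ 2 ∧ x * y ≠ -2 := by
      rintro _ _ ⟨x, rfl⟩ ⟨y, rfl⟩
      constructor <;> intro h <;> ring_nf at h <;> omega
    rcases mul_eq_zero.1 hz'.1 with rfl | rfl <;> rcases mul_eq_zero.1 hz'.2 with rfl | rfl
    · simp at hD
    · have := four l₂ j₁ (e₂.2 (by simp)) (e₁.1 (by simp)); simp at hD; omega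
    · have := four l₁ j₂ (e₁.2 (by simp)) (e₂.1 (by simp)); simp at hD; omega
    · simp at hD
  -- The product is `(l₁j₂)(l₂j₁)`, whose factors differ by `2`, so it has the form `x² - 1`; being
  -- negative it is `-1`. Orthogonality then forces `A² = B²`.
  · have hP : (l₁ * l₂) * (j₁ * j₂) = -1 := by
      have h5 : (l₁ * l₂) * (j₁ * j₂) = (l₁ * j₂) * (l₂ * j₁) := by ring
      rcases hD with h | h
      · have h6 : l₁ * j₂ = l₂ * j₁ + 2 := by omega
        rw [h5, h6] at hz hle ⊢
        nlinarith [sq_nonneg (l₂ * j₁ + 1), lt_of_le_of_ne hle hz]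
      · have h6 : l₁ * j₂ = l₂ * j₁ - 2 := by omega
        rw [h5, h6] at hz hle ⊢
        nlinarith [sq_nonneg (l₂ * j₁ - 1), lt_of_le_of_ne hle hz]
    have hAB : B ^ 2 < A ^ 2 := by gcongr
    rcases Int.mul_eq_neg_one_iff_eq_one_or_neg_one.1 hP with ⟨h, h'⟩ | ⟨h, h'⟩ <;>
    · rw [h, h'] at horth'
      push_cast at horth'
      linarith

lemma compactSpace_quotient {a b : ℝ} (ha : 0 < a) (hb : 0 < b) (hv : (a, 0) ∈ L)
    (hw : (0, b) ∈ L) : CompactSpace ((ℝ × ℝ) ⧸ L) := by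
  have hc : IsCompact ((QuotientAddGroup.mk : ℝ × ℝ → (ℝ × ℝ) ⧸ L) ''
      (Set.Icc 0 a ×ˢ Set.Icc 0 b)) :=
    (isCompact_Icc.prod isCompact_Icc).image QuotientAddGroup.continuous_mk
  refine ⟨?_⟩
  convert hc
  refine (Set.eq_univ_of_forall fun x => ?_).symm
  induction x using QuotientAddGroup.induction_on with
  | H p =>
    obtain ⟨c, hc, -⟩ := existsUnique_add_zsmul_mem_Ico ha p.1 0
    obtain ⟨d, hd, -⟩ := existsUnique_add_zsmul_mem_Ico hb p.2 0
    rw [zero_add] at hc hd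
    refine ⟨(p.1 + c • a, p.2 + d • b), ⟨Set.Ico_subset_Icc_self hc, Set.Ico_subset_Icc_self hd⟩, ?_⟩
    rw [eq_comm, QuotientAddGroup.eq]
    convert L.add_mem (L.zsmul_mem hv c) (L.zsmul_mem hw d) using 1
    ext <;> simp

end Lattice

/-- A continuous injection from a compact space into a Hausdorff space is a closed embedding. -/
lemma isEmbedding_quotientMap {u : ℝ × ℝ → C3} [CompactSpace (PeriodQuotient u)]
    (hu : Continuous u) (h : ∀ p q, u p = u q → q - p ∈ periodGroup u) :
    Topology.IsEmbedding (quotientMap u) := by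
  have hc : Continuous (quotientMap u) := continuous_quot_lift _ hu
  refine (hc.isClosedEmbedding fun x y => ?_).isEmbedding
  induction x using QuotientAddGroup.induction_on with
  | H p =>
    induction y using QuotientAddGroup.induction_on with
    | H q =>
      intro hpq
      rw [QuotientAddGroup.eq, neg_add_eq_sub]
      exact h p q hpq

/-! ### Level sets of `u_{α,0}` -/

/-- The parity of `j` records the sign `ε`, so that parities from different components can be
compared. -/
lemma exists_int_mul_pi_of_cos_sin_eq {φ ψ ε : ℝ} (hε : ε = 1 ∨ ε = -1)
    (hc : Real.cos ψ = ε * Real.cos φ) (hs : Real.sin ψ = ε * Real.sin φ) :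
    ∃ j : ℤ, ψ = φ + j * Real.pi ∧ (Even j ↔ ε = 1) := by
  rcases hε with rfl | rfl
  · have h := Real.Angle.cos_sin_inj (θ := ψ) (ψ := φ) (by simpa using hc) (by simpa using hs)
    obtain ⟨j, hj⟩ := Real.Angle.angle_eq_iff_two_pi_dvd_sub.1 h
    exact ⟨2 * j, by push_cast; linarith, by simp⟩
  · have h := Real.Angle.cos_sin_inj (θ := ψ) (ψ := φ + Real.pi)
      (by simpa [Real.cos_add_pi] using hc) (by simpa [Real.sin_add_pi] using hs)
    obtain ⟨j, hj⟩ := Real.Angle.angle_eq_iff_two_pi_dvd_sub.1 h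
    exact ⟨2 * j + 1, by push_cast; linarith, by norm_num⟩

lemma exists_int_mul_pi_of_exp_eq {x ε : ℝ} (hε : ε = 1 ∨ ε = -1)
    (h : Complex.exp (Complex.I * x) = ε) : ∃ j : ℤ, x = j * Real.pi ∧ (Even j ↔ ε = 1) := by
  rw [mul_comm] at h
  have hc : Real.cos x = ε := by rw [← Complex.exp_ofReal_mul_I_re, h, Complex.ofReal_re]
  have hs : Real.sin x = 0 := by rw [← Complex.exp_ofReal_mul_I_im, h, Complex.ofReal_im]
  simpa using exists_int_mul_pi_of_cos_sin_eq (φ := 0) hε (by simpa using hc) (by simpa using hs)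

lemma exp_I_mul_int_mul_pi (j : ℤ) :
    Complex.exp (Complex.I * ((j * Real.pi : ℝ) : ℂ)) = (((-1) ^ j : ℝ) : ℂ) := by
  have h : Complex.I * ((j * Real.pi : ℝ) : ℂ) = j * (Real.pi * Complex.I) := by push_cast; ring
  rw [h, Complex.exp_int_mul, Complex.exp_pi_mul_I]
  push_cast
  rfl

lemma neg_one_zpow_congr {a b : ℤ} (h : Even a ↔ Even b) : (-1 : ℝ) ^ a = (-1) ^ b := by
  by_cases hb : Even b
  · rw [hb.neg_one_zpow, (h.2 hb).neg_one_zpow]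
  · have ha : ¬ Even a := fun ha => hb (h.1 ha)
    rw [(Int.not_even_iff_odd.1 hb).neg_one_zpow, (Int.not_even_iff_odd.1 ha).neg_one_zpow]

/-- Two inverse unit complex numbers that multiply a nonzero real vector into a real one are a
common sign. -/
lemma exists_sign_of_real_vector {w₁ w₂ : ℂ} {x y x' y' : ℝ} (hw : w₁ * w₂ = 1) (hn : ‖w₁‖ = 1)
    (hx : w₁ * x' = x) (hy : w₂ * y' = y) (h0 : x' ≠ 0 ∨ y' ≠ 0) :
    ∃ ε : ℝ, (ε = 1 ∨ ε = -1) ∧ w₁ = ε ∧ w₂ = ε ∧ x' = ε * x ∧ y' = ε * y := by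
  -- A unit number carrying a nonzero real to a real is itself real, hence `±1`.
  have real : ∀ {w : ℂ} {a b : ℝ}, ‖w‖ = 1 → w * b = a → b ≠ 0 → w = 1 ∨ w = -1 := by
    intro w a b hw h hb
    have h1 : w = ((a / b : ℝ) : ℂ) := by
      have : (b : ℂ) ≠ 0 := by exact_mod_cast hb
      push_cast
      rw [← h]; field_simp
    rw [h1, Complex.norm_real, Real.norm_eq_abs] at hw
    rcases eq_or_eq_neg_of_abs_eq hw with h2 | h2 <;> rw [h1, h2] <;> simp
  have hn2 : ‖w₂‖ = 1 := by simpa [hn] using congrArg norm hw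
  have h1 : w₁ = 1 ∨ w₁ = -1 := by
    rcases h0 with h | h
    · exact real hn hx h
    · rcases real hn2 hy h with h | h <;> rw [h] at hw
      · left; simpa using hw
      · right; linear_combination -hw
  rcases h1 with rfl | rfl
  · obtain rfl : w₂ = 1 := by simpa using hw
    refine ⟨1, by simp, by simp, by simp, ?_, ?_⟩
    · simpa using hx
    · simpa using hy
  · obtain rfl : w₂ = -1 := by linear_combination -hw
    refine ⟨-1, by simp, by simp, by simp, ?_, ?_⟩
    · have h : ((-x' : ℝ) : ℂ) = x := by simpa using hx
      linarith [Complex.ofReal_injective h]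
    · have h : ((-y' : ℝ) : ℂ) = y := by simpa using hy
      linarith [Complex.ofReal_injective h]

variable {α θ : ℝ}

lemma uZero_eq_iff (p q : ℝ × ℝ) :
    uZero α θ p = uZero α θ q ↔
      Complex.exp (Complex.I * ((q.1 - p.1 : ℝ) : ℂ)) * R1 α q.2 = R1 α p.2 ∧
      Complex.exp (Complex.I * ((α * (q.1 - p.1) : ℝ) : ℂ)) * R2 α q.2 = R2 α p.2 ∧
      Complex.exp (Complex.I * (((-1 - α) * (q.1 - p.1) : ℝ) : ℂ)) * R3 α q.2 = R3 α p.2 := by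
  have key : ∀ (l : ℝ) (c x y : ℂ), c ≠ 0 →
      (Complex.exp (Complex.I * l * p.1) * (c * x) = Complex.exp (Complex.I * l * q.1) * (c * y) ↔
        Complex.exp (Complex.I * ((l * (q.1 - p.1) : ℝ) : ℂ)) * y = x) := by
    intro l c x y hc
    have he : Complex.exp (Complex.I * l * q.1) = Complex.exp (Complex.I * l * p.1) *
        Complex.exp (Complex.I * ((l * (q.1 - p.1) : ℝ) : ℂ)) := by
      rw [← Complex.exp_add]; congr 1; push_cast; ring
    rw [he]
    have hne := mul_ne_zero (Complex.exp_ne_zero (Complex.I * l * p.1)) hc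
    constructor
    · intro h
      refine (mul_left_cancel₀ hne ?_).symm
      linear_combination h
    · rintro rfl
      ring
  have hphase : ∀ j, phase θ j ≠ 0 := fun j h => by simpa [h] using conj_phase_mul_self θ j
  rw [uZero_eq_wave, wave, wave, (WithLp.toLp_injective 2).eq_iff, funext_iff, Fin.forall_fin_succ,
    Fin.forall_fin_succ, Fin.forall_fin_succ]
  simp only [key _ _ _ _ (hphase _)]
  simp [freq, profile]

lemma R3_pos (h0 : 0 < α) (h1 : α ≤ 1) (t : ℝ) : 0 < R3 α t :=
  mul_pos (Real.sqrt_pos.2 (by positivity)) (dn_pos (kOf_sq_lt_one h0 h1) _)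

lemma uZero_eq_iff_exists_int {m n : ℕ} (hm : 0 < m) (hmn : m ≤ n) (hcop : Nat.Coprime m n)
    (hα : α = (m : ℝ) / (n : ℝ)) (p q : ℝ × ℝ) :
    uZero α θ p = uZero α θ q ↔ ∃ l j : ℤ,
      q - p = (l * (n * Real.pi), j * (2 * Ke (kOf α) / rOf α)) ∧
      (Even (n * l) ↔ Even j) ∧ (Even (m * l) ↔ Even j) := by
  have hn : 0 < n := hm.trans_le hmn
  have hn' : (0 : ℝ) < n := by exact_mod_cast hn
  have hm' : (0 : ℝ) < m := by exact_mod_cast hm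
  have h0 : 0 < α := hα ▸ by positivity
  have h1 : α ≤ 1 := hα ▸ (div_le_one hn').2 (by exact_mod_cast hmn)
  have hk := kOf_sq_lt_one h0 h1
  have hr := rOf_pos h0
  have hαn : α * n = m := by rw [hα]; field_simp
  have c1 : 0 < √((1 + α) / (2 + α)) := Real.sqrt_pos.2 (by positivity)
  have c2 : 0 < √((1 + α) / (1 + 2 * α)) := Real.sqrt_pos.2 (by positivity)
  rw [uZero_eq_iff]
  constructor
  · rintro ⟨e1, e2, e3⟩
    have hnorm : ∀ x : ℝ, ‖Complex.exp (Complex.I * x)‖ = 1 := fun x => by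
      rw [mul_comm, Complex.norm_exp_ofReal_mul_I]
    have h3 : R3 α q.2 = R3 α p.2 := by
      have h := congrArg norm e3
      rwa [norm_mul, hnorm, one_mul, Complex.norm_real, Complex.norm_real,
        Real.norm_of_nonneg (R3_pos h0 h1 _).le, Real.norm_of_nonneg (R3_pos h0 h1 _).le] at h
    have h3' : Complex.exp (Complex.I * (((-1 - α) * (q.1 - p.1) : ℝ) : ℂ)) = 1 := by
      have hne : (R3 α p.2 : ℂ) ≠ 0 := by exact_mod_cast (R3_pos h0 h1 _).ne'
      rw [h3] at e3
      exact (mul_eq_right₀ hne).1 e3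
    -- The frequencies `1`, `α`, `-1 - α` sum to zero.
    have hw : Complex.exp (Complex.I * ((q.1 - p.1 : ℝ) : ℂ)) *
        Complex.exp (Complex.I * ((α * (q.1 - p.1) : ℝ) : ℂ)) = 1 := by
      rw [← mul_one (_ * _), ← h3', ← Complex.exp_add, ← Complex.exp_add, h3', ← Complex.exp_zero]
      congr 1
      push_cast
      ring
    have hcs : R1 α q.2 ≠ 0 ∨ R2 α q.2 ≠ 0 := by
      by_contra! h
      have h4 := sum_freq_mul_profile_sq h0 h1 q.2
      have h5 := sum_profile_sq h0 h1 q.2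
      rw [h.1, h.2] at h4 h5
      nlinarith
    obtain ⟨ε, hε, w1, w2, x1, x2⟩ := exists_sign_of_real_vector hw (hnorm _) e1 e2 hcs
    obtain ⟨a, ha, hae⟩ := exists_int_mul_pi_of_exp_eq hε w1
    obtain ⟨b, hb, hbe⟩ := exists_int_mul_pi_of_exp_eq hε w2
    obtain ⟨j, hj, hje⟩ := exists_int_mul_pi_of_cos_sin_eq
      (φ := am (kOf α) (rOf α * p.2)) (ψ := am (kOf α) (rOf α * q.2)) hε
      (mul_left_cancel₀ c1.ne' (x1.trans (by rw [R1, cn]; ring)))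
      (mul_left_cancel₀ c2.ne' (x2.trans (by rw [R2, sn]; ring)))
    have ht := eq_add_of_am_eq hk hj
    -- The shift of `s` is `aπ` and `α` times it is `bπ`; coprimality then gives `a = nl` and `b =
    -- ml`.
    have hab : (m : ℤ) * a = n * b := by
      have : (m : ℝ) * a = n * b := by
        refine mul_right_cancel₀ Real.pi_pos.ne' ?_
        rw [← hαn]
        rw [ha] at hb
        linear_combination (n : ℝ) * hb
      exact_mod_cast this
    obtain ⟨l, rfl⟩ : (n : ℤ) ∣ a :=
      (Nat.isCoprime_iff_coprime.2 hcop.symm).dvd_of_dvd_mul_left ⟨b, hab⟩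
    obtain rfl : b = m * l := by
      have : (n : ℤ) ≠ 0 := by exact_mod_cast hn.ne'
      refine mul_left_cancel₀ this ?_
      linear_combination -hab
    refine ⟨l, j, ?_, hae.trans hje.symm, hbe.trans hje.symm⟩
    ext
    · simp only [Prod.fst_sub, ha]; push_cast; ring
    · simp only [Prod.snd_sub]
      field_simp
      linear_combination ht
  · rintro ⟨l, j, hpq, hnl, hml⟩
    have hs : q.1 - p.1 = ((n * l : ℤ) : ℝ) * Real.pi := by
      have := congrArg Prod.fst hpq
      simp only [Prod.fst_sub] at this
      rw [this]; push_cast; ring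
    have hαs : α * (q.1 - p.1) = ((m * l : ℤ) : ℝ) * Real.pi := by
      rw [hs]; push_cast; rw [← hαn]; ring
    have hβs : (-1 - α) * (q.1 - p.1) = ((-(n * l + m * l) : ℤ) : ℝ) * Real.pi := by
      push_cast at hs hαs ⊢
      linear_combination -hs - hαs
    have ht : am (kOf α) (rOf α * q.2) = am (kOf α) (rOf α * p.2) + j * Real.pi := by
      rw [← am_add_int_mul_Ke hk]
      congr 1
      have := congrArg Prod.snd hpq
      simp only [Prod.snd_sub] at this
      field_simp at this
      linear_combination this
    have hsq : ((-1 : ℝ) ^ j) * (-1) ^ j = 1 := by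
      rw [← mul_zpow]; simp
    have hsn : sn (rOf α * q.2) (kOf α) = (-1) ^ j * sn (rOf α * p.2) (kOf α) := by
      rw [sn, sn, ht, Real.sin_add_int_mul_pi]
    have hcn : cn (rOf α * q.2) (kOf α) = (-1) ^ j * cn (rOf α * p.2) (kOf α) := by
      rw [cn, cn, ht, Real.cos_add_int_mul_pi]
    have hdn : dn (rOf α * q.2) (kOf α) = dn (rOf α * p.2) (kOf α) := by
      rw [dn, dn, hsn, mul_pow, pow_two ((-1 : ℝ) ^ j), hsq, one_mul]
    rw [hβs, hαs, hs]
    simp only [exp_I_mul_int_mul_pi]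
    -- Both `nl` and `ml` have the parity of `j`, so their sum is even.
    have hsum : (-1 : ℝ) ^ (-(n * l + m * l) : ℤ) = 1 :=
      Even.neg_one_zpow (by rw [even_neg, Int.even_add]; exact hnl.trans hml.symm)
    rw [neg_one_zpow_congr hnl, neg_one_zpow_congr hml, hsum]
    simp only [← Complex.ofReal_mul]
    refine ⟨congrArg _ ?_, congrArg _ ?_, congrArg _ ?_⟩
    · rw [R1, R1, hcn]; linear_combination (√((1 + α) / (2 + α)) * cn (rOf α * p.2) (kOf α)) * hsq
    · rw [R2, R2, hsn]
      linear_combination (√((1 + α) / (1 + 2 * α)) * sn (rOf α * p.2) (kOf α)) * hsq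
    · rw [R3, R3, hdn, one_mul]

/-- By `Ke_mul_sqrt_le` it suffices that `n r √(1 - k²) > 1`, and the square of the left side is `m²
+ 2mn`. -/
lemma two_mul_Ke_div_rOf_lt {m n : ℕ} (hm : 0 < m) (hmn : m ≤ n) (hα : α = (m : ℝ) / (n : ℝ)) :
    2 * Ke (kOf α) / rOf α < n * Real.pi := by
  have hn' : (1 : ℝ) ≤ n := by exact_mod_cast hm.trans_le hmn
  have hm' : (1 : ℝ) ≤ m := by exact_mod_cast hm
  have h0 : 0 < α := hα ▸ by positivity
  have h1 : α ≤ 1 := hα ▸ (div_le_one (by positivity)).2 (by exact_mod_cast hmn)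
  have hαn : α * n = m := by rw [hα]; field_simp
  have hk := kOf_sq_lt_one h0 h1
  have hr := rOf_pos h0
  have hpos : 0 < √(1 - kOf α ^ 2) := Real.sqrt_pos.2 (by linarith)
  have hle := Ke_mul_sqrt_le hk
  have hlt : 1 < n * (rOf α * √(1 - kOf α ^ 2)) := by
    refine (one_lt_sq_iff₀ (by positivity)).1 ?_
    rw [mul_pow, mul_pow, Real.sq_sqrt (by linarith), rOf_sq h0, kOf_sq h0 h1]
    have : (n : ℝ) ^ 2 * ((1 + 2 * α) * (1 - (1 - α ^ 2) / (1 + 2 * α))) =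
        m ^ 2 + 2 * m * n := by
      rw [← hαn]; field_simp; ring
    rw [this]
    nlinarith
  rw [div_lt_iff₀ hr]
  refine lt_of_mul_lt_mul_right ?_ hpos.le
  calc 2 * Ke (kOf α) * √(1 - kOf α ^ 2) ≤ Real.pi * 1 := by linarith
    _ < Real.pi * (n * (rOf α * √(1 - kOf α ^ 2))) := by gcongr
    _ = _ := by ring

/-! ### Extreme curvatures and the period group. -/

lemma isLeast_gaussCurvature (h0 : 0 < α) (h1 : α ≤ 1) :
    IsLeast (Set.range (gaussCurvature (uZero α θ))) (1 - 2 / (α * (1 + α))) := by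
  have hK : 1 - 2 / (α * (1 + α)) = 1 - 2 * (α * (1 + α)) ^ 2 / (α * (1 + α)) ^ 3 := by
    field_simp
  rw [hK]
  constructor
  -- Here the amplitude is `π / 2`, so `sn = 1` and the conformal factor is smallest.
  · refine ⟨(0, Ke (kOf α) / rOf α), ?_⟩
    have hs : sn (rOf α * (Ke (kOf α) / rOf α)) (kOf α) = 1 := by
      rw [mul_div_cancel₀ _ (rOf_pos h0).ne', sn, am_Ke (kOf_sq_lt_one h0 h1), Real.sin_pi_div_two]
    rw [gaussCurvature_uZero θ h0 h1, conformalFactor, hs]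
    congr 3
    ring
  · rintro _ ⟨p, rfl⟩
    rw [gaussCurvature_uZero θ h0 h1]
    have := le_conformalFactor h0 h1 p.2
    gcongr

lemma isGreatest_gaussCurvature (h0 : 0 < α) (h1 : α ≤ 1) :
    IsGreatest (Set.range (gaussCurvature (uZero α θ))) (1 - 2 * α ^ 2 / (1 + α)) := by
  have hK : 1 - 2 * α ^ 2 / (1 + α) = 1 - 2 * (α * (1 + α)) ^ 2 / (1 + α) ^ 3 := by
    field_simp
  rw [hK]
  constructor
  · refine ⟨(0, 0), ?_⟩
    have hs : sn (rOf α * 0) (kOf α) = 0 := by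
      rw [mul_zero, sn, am_zero (kOf_sq_lt_one h0 h1), Real.sin_zero]
    rw [gaussCurvature_uZero θ h0 h1, conformalFactor, hs]
    congr 3
    ring
  · rintro _ ⟨p, rfl⟩
    rw [gaussCurvature_uZero θ h0 h1]
    have := conformalFactor_le h0 h1 p.2
    have := conformalFactor_pos h0 h1 p.2
    gcongr

/-- The criterion for `u p = u q` sees only `q - p`, so agreement at the origin already makes `ω` a
period. -/
lemma mem_periodGroup_uZero {m n : ℕ} (hm : 0 < m) (hmn : m ≤ n) (hcop : Nat.Coprime m n)
    (hα : α = (m : ℝ) / (n : ℝ)) (ω : ℝ × ℝ) :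
    ω ∈ periodGroup (uZero α θ) ↔ ∃ l j : ℤ,
      ω = (l * (n * Real.pi), j * (2 * Ke (kOf α) / rOf α)) ∧
      (Even (n * l) ↔ Even j) ∧ (Even (m * l) ↔ Even j) := by
  have h := fun p => uZero_eq_iff_exists_int (θ := θ) hm hmn hcop hα p (p + ω)
  simp only [add_sub_cancel_left] at h
  exact ⟨fun hω => (h 0).1 (hω 0).symm, fun hω p => ((h p).2 hω).symm⟩

end LegendrianTori

end

theorem mainTheorem6 (θ α : ℝ) (m n : ℕ) (hm : 0 < m) (hmn : m ≤ n) (hcop : Nat.Coprime m n)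
    (hα : α = (m : ℝ) / (n : ℝ)) :
    LegendrianTori.IsMinimalLegendrianImmersion (LegendrianTori.uZero α θ) ∧
    LegendrianTori.DoublyPeriodic (LegendrianTori.uZero α θ) ∧
    (Even (m * n) →
      LegendrianTori.IsLatticeBasis (LegendrianTori.periodGroup (LegendrianTori.uZero α θ))
        (2 * (n : ℝ) * Real.pi, 0)
        (0, 4 * LegendrianTori.Ke (LegendrianTori.kOf α) / LegendrianTori.rOf α) ∧
      LegendrianTori.IsRectangular (LegendrianTori.periodGroup (LegendrianTori.uZero α θ))) ∧
    (¬ Even (m * n) →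
      LegendrianTori.IsLatticeBasis (LegendrianTori.periodGroup (LegendrianTori.uZero α θ))
        (2 * (n : ℝ) * Real.pi, 0)
        ((n : ℝ) * Real.pi,
          2 * LegendrianTori.Ke (LegendrianTori.kOf α) / LegendrianTori.rOf α) ∧
      ¬ LegendrianTori.IsRectangular (LegendrianTori.periodGroup (LegendrianTori.uZero α θ))) ∧
    Topology.IsEmbedding (LegendrianTori.quotientMap (LegendrianTori.uZero α θ)) ∧
    IsLeast (Set.range (LegendrianTori.gaussCurvature (LegendrianTori.uZero α θ)))
      (1 - 2 / (α * (1 + α))) ∧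
    IsGreatest (Set.range (LegendrianTori.gaussCurvature (LegendrianTori.uZero α θ)))
      (1 - 2 * α ^ 2 / (1 + α)) := by
  open LegendrianTori in
  have hn : 0 < n := hm.trans_le hmn
  have hn' : (0 : ℝ) < n := by exact_mod_cast hn
  have hm' : (0 : ℝ) < m := by exact_mod_cast hm
  have h0 : 0 < α := hα ▸ by positivity
  have h1 : α ≤ 1 := hα ▸ (div_le_one hn').2 (by exact_mod_cast hmn)
  have hL := mem_periodGroup_uZero (θ := θ) hm hmn hcop hα
  have hA : 0 < n * Real.pi := by positivity
  have hB : 0 < 2 * Ke (kOf α) / rOf α :=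
    div_pos (mul_pos two_pos (Ke_pos (kOf_sq_lt_one h0 h1))) (rOf_pos h0)
  have hBA := two_mul_Ke_div_rOf_lt hm hmn hα
  have hmin := isMinimalLegendrianImmersion_uZero θ h0 h1
  have hA2 : 2 * (n : ℝ) * Real.pi = 2 * (n * Real.pi) := by ring
  have hB2 : 4 * Ke (kOf α) / rOf α = 2 * (2 * Ke (kOf α) / rOf α) := by ring
  rw [hA2, hB2]
  have hv : (2 * (n * Real.pi), 0) ∈ periodGroup (uZero α θ) :=
    (hL _).2 ⟨2, 0, by simp, by simp, by simp⟩
  have hw : (0, 2 * (2 * Ke (kOf α) / rOf α)) ∈ periodGroup (uZero α θ) :=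
    (hL _).2 ⟨0, 2, by simp, by simp, by simp⟩
  refine ⟨hmin, ⟨_, hv, _, hw, ?_⟩, fun he => ?_, fun ho => ?_, ?_,
    isLeast_gaussCurvature h0 h1, isGreatest_gaussCurvature h0 h1⟩
  · rw [LinearIndependent.pair_iff]
    intro s t h
    simpa [(rOf_pos h0).ne', (Ke_pos (kOf_sq_lt_one h0 h1)).ne', hn'.ne', Real.pi_pos.ne'] using h
  · have hmn_odd : ¬ (Even m ∧ Even n) := fun h =>
      Nat.not_coprime_of_dvd_of_dvd one_lt_two h.1.two_dvd h.2.two_dvd hcop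
    -- Exactly one of `m`, `n` is even: the even one forces `j` even, and then the odd one forces
    -- `l` even.
    have hL' : ∀ ω, ω ∈ periodGroup (uZero α θ) ↔ ∃ l j : ℤ,
        ω = (l * (n * Real.pi), j * (2 * Ke (kOf α) / rOf α)) ∧ Even l ∧ Even j := fun ω => by
      rw [hL]
      refine exists_congr fun l => exists_congr fun j => and_congr_right fun _ => ?_
      rw [Nat.even_mul] at he
      rw [Int.even_mul, Int.even_mul, Int.even_coe_nat, Int.even_coe_nat]
      tauto
    exact ⟨isLatticeBasis_rectangular hA hB hL', isRectangular_of_even hA hB hL'⟩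
  -- Both `m` and `n` are odd, so the two parity conditions coincide.
  · have hL' : ∀ ω, ω ∈ periodGroup (uZero α θ) ↔ ∃ l j : ℤ,
        ω = (l * (n * Real.pi), j * (2 * Ke (kOf α) / rOf α)) ∧ (Even l ↔ Even j) := fun ω => by
      rw [hL]
      refine exists_congr fun l => exists_congr fun j => and_congr_right fun _ => ?_
      rw [Nat.even_mul] at ho
      rw [Int.even_mul, Int.even_mul, Int.even_coe_nat, Int.even_coe_nat]
      tauto
    exact ⟨isLatticeBasis_rhombic hA hB hL', not_isRectangular_rhombic hB hBA hL'⟩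
  · have : CompactSpace (PeriodQuotient (uZero α θ)) :=
      compactSpace_quotient (by positivity) (by positivity) hv hw
    refine isEmbedding_quotientMap hmin.smooth.continuous fun p q h => ?_
    exact (hL _).2 ((uZero_eq_iff_exists_int hm hmn hcop hα p q).1 h)
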